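/- All Hilbert spaces are complex and finite-dimensional. For such a space $\mathcal H$, let $\mathcal L(\mathcal H)$ be the linear operators on $\mathcal H$ and $\mathcal S(\mathcal H)\subset\mathcal L(\mathcal H)$ the density operators (positive semidefinite operators of unit trace); a linear map $V$ is an isometry if $V^\dagger V=\mathbb 1$. **Proposition.** Let $\mathcal H_A,\mathcal H_B,\mathcal H_{A'},\mathcal H_{B'}$ be finite-dimensional Hilbert spaces. Let $\Phi_{A'B'}\in\mathcal S(\mathcal H_{A'}\otimes\mathcal H_{B'})$ be pure, i.e. $\Phi_{A'B'}^2=\Phi_{A'B'}$, with full-rank marginals: $\operatorname{rank}(\operatorname{tr}_{B'}\Phi_{A'B'})=\dim\mathcal H_{A'}$ and $\operatorname{rank}(\operatorname{tr}_{A'}\Phi_{A'B'})=\dim\mathcal H_{B'}$. Let $\rho_{AB}\in\mathcal S(\mathcal H_A\otimes\mathcal H_B)$ be arbitrary. The following three statements are equivalent. 1. There exist completely positive trace-preserving linear maps $\Lambda_A:\mathcal L(\mathcal H_A)\to\mathcal L(\mathcal H_{A'})$ and $\Lambda_B:\mathcal L(\mathcal H_B)\to\mathcal L(\mathcal H_{B'})$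 such that $$(\Lambda_A\otimes\Lambda_B)(\rho_{AB})=\Phi_{A'B'}.$$ 2. There exist finite-dimensional Hilbert spaces $\mathcal H_{A''},\mathcal H_{B''}$, isometries $V_A:\mathcal H_A\to\mathcal H_{A'}\otimes\mathcal H_{A''}$ and $V_B:\mathcal H_B\to\mathcal H_{B'}\otimes\mathcal H_{B''}$, and a state $\sigma_{A''B''}\in\mathcal S(\mathcal H_{A''}\otimes\mathcal H_{B''})$ such that, with $V=V_A\otimes V_B$, $$V\rho_{AB}V^\dagger=\Phi_{A'B'}\otimes\sigma_{A''B''}.$$ 3. There exist finite-dimensional Hilbert spaces $\mathcal H_{A'''},\mathcal H_{B'''}$, isometries $W_A:\mathcal H_{A'}\otimes\mathcal H_{A'''}\to\mathcal H_A$ and $W_B:\mathcal H_{B'}\otimes\mathcal H_{B'''}\to\mathcal H_B$, and a state $\tau_{A'''B'''}\in\mathcal S(\mathcal H_{A'''}\otimes\mathcal H_{B'''})$ such that, with $W=W_A\otimes W_B$, $$\rho_{AB}=W\,(\Phi_{A'B'}\otimes\tau_{A'''B'''})\,W^\dagger.$$ In 2 and 3 the tensor factors are identified by the canonical reordering $(\mathcal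 H_{A'}\otimes\mathcal H_{B'})\otimes(\mathcal H_{A''}\otimes\mathcal H_{B''})\cong(\mathcal H_{A'}\otimes\mathcal H_{A''})\otimes(\mathcal H_{B'}\otimes\mathcal H_{B''})$ (and likewise with $'''$ in place of $''$). -/

import Mathlib

open scoped TensorProduct CStarAlgebra

namespace SelfTesting

noncomputable section

/-- A density operator: a positive semidefinite operator of unit trace. -/
def IsDensity {H : Type*} [NormedAddCommGroup H] [InnerProductSpace ℂ H]
    (ρ : H →L[ℂ] H) : Prop :=
  ρ.IsPositive ∧ LinearMap.trace ℂ H ρ.toLinearMap = 1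

/-- For an isometry `V`, the map `T ↦ V T V†`. -/
def conjIsometry {H K : Type*} [NormedAddCommGroup H] [InnerProductSpace ℂ H]
    [FiniteDimensional ℂ H] [CompleteSpace H]
    [NormedAddCommGroup K] [InnerProductSpace ℂ K] [CompleteSpace K]
    (V : H →ₗᵢ[ℂ] K) (T : H →L[ℂ] H) : K →L[ℂ] K :=
  V.toContinuousLinearMap ∘L T ∘L ContinuousLinearMap.adjoint V.toContinuousLinearMap

section FiniteDimensional

variable (H K : Type*)
  [NormedAddCommGroup H] [InnerProductSpace ℂ H] [FiniteDimensional ℂ H]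
  [NormedAddCommGroup K] [InnerProductSpace ℂ K] [FiniteDimensional ℂ K]

/-- The canonical identification `L(H) ⊗ L(K) ≃ L(H ⊗ K)`, sending the formal tensor `S ⊗ₜ T` to
the operator `S ⊗ T` on `H ⊗ K`. -/
def opTensorEquiv :
    ((H →L[ℂ] H) ⊗[ℂ] (K →L[ℂ] K)) ≃ₗ[ℂ] (H ⊗[ℂ] K →L[ℂ] H ⊗[ℂ] K) :=
  (TensorProduct.congr LinearMap.toContinuousLinearMap.symm
      LinearMap.toContinuousLinearMap.symm).trans
    ((homTensorHomEquiv ℂ H K H K).trans LinearMap.toContinuousLinearMap)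

theorem opTensorEquiv_tmul (S : H →L[ℂ] H) (T : K →L[ℂ] K) :
    opTensorEquiv H K (S ⊗ₜ[ℂ] T) = TensorProduct.mapL S T := by
  ext x
  simp [opTensorEquiv]

/-- The trace functional on `L(H)`. -/
def traceL : (H →L[ℂ] H) →ₗ[ℂ] ℂ :=
  LinearMap.trace ℂ H ∘ₗ LinearMap.toContinuousLinearMap.symm.toLinearMap

variable {H K}

/-- The partial trace `tr_K : L(H ⊗ K) → L(H)` over the second factor. -/
def partialTraceRight : (H ⊗[ℂ] K →L[ℂ] H ⊗[ℂ] K) →ₗ[ℂ] (H →L[ℂ] H) :=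
  (TensorProduct.rid ℂ (H →L[ℂ] H)).toLinearMap ∘ₗ
    TensorProduct.map LinearMap.id (traceL K) ∘ₗ (opTensorEquiv H K).symm.toLinearMap

/-- The partial trace `tr_H : L(H ⊗ K) → L(K)` over the first factor. -/
def partialTraceLeft : (H ⊗[ℂ] K →L[ℂ] H ⊗[ℂ] K) →ₗ[ℂ] (K →L[ℂ] K) :=
  (TensorProduct.lid ℂ (K →L[ℂ] K)).toLinearMap ∘ₗ
    TensorProduct.map (traceL H) LinearMap.id ∘ₗ (opTensorEquiv H K).symm.toLinearMap

/-- An operator on `H` has full rank if its rank is `dim H`. -/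
def FullRank (T : H →L[ℂ] H) : Prop :=
  Module.finrank ℂ (LinearMap.range T.toLinearMap) = Module.finrank ℂ H

/-- A linear map between operator spaces preserves the trace. -/
def IsTracePreserving (Λ : (H →L[ℂ] H) →ₗ[ℂ] (K →L[ℂ] K)) : Prop :=
  ∀ T : H →L[ℂ] H, LinearMap.trace ℂ K (Λ T).toLinearMap = LinearMap.trace ℂ H T.toLinearMap

variable {H' K' : Type*}
  [NormedAddCommGroup H'] [InnerProductSpace ℂ H'] [FiniteDimensional ℂ H']
  [NormedAddCommGroup K'] [InnerProductSpace ℂ K'] [FiniteDimensional ℂ K']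

/-- The tensor product `Λ ⊗ Γ : L(H ⊗ K) → L(H' ⊗ K')` of two linear maps between operator spaces,
i.e. the linear map with `(Λ ⊗ Γ)(S ⊗ T) = Λ(S) ⊗ Γ(T)`. -/
def channelTensor (Λ : (H →L[ℂ] H) →ₗ[ℂ] (H' →L[ℂ] H')) (Γ : (K →L[ℂ] K) →ₗ[ℂ] (K' →L[ℂ] K')) :
    (H ⊗[ℂ] K →L[ℂ] H ⊗[ℂ] K) →ₗ[ℂ] (H' ⊗[ℂ] K' →L[ℂ] H' ⊗[ℂ] K') :=
  (opTensorEquiv H' K').toLinearMap ∘ₗ TensorProduct.map Λ Γ ∘ₗ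
    (opTensorEquiv H K).symm.toLinearMap

end FiniteDimensional

/-- The unitary `(H ⊗ K) ⊗ (H' ⊗ K') ≃ (H ⊗ H') ⊗ (K ⊗ K')` exchanging the two middle tensor
factors. -/
def swapMiddle (H K H' K' : Type*)
    [NormedAddCommGroup H] [InnerProductSpace ℂ H]
    [NormedAddCommGroup K] [InnerProductSpace ℂ K]
    [NormedAddCommGroup H'] [InnerProductSpace ℂ H']
    [NormedAddCommGroup K'] [InnerProductSpace ℂ K'] :
    (H ⊗[ℂ] K) ⊗[ℂ] (H' ⊗[ℂ] K') ≃ₗᵢ[ℂ] (H ⊗[ℂ] H') ⊗[ℂ] (K ⊗[ℂ] K') :=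
  (TensorProduct.assocIsometry ℂ H K (H' ⊗[ℂ] K')).trans
    ((LinearIsometryEquiv.lTensor H
      (((TensorProduct.assocIsometry ℂ K H' K').symm.trans
        (LinearIsometryEquiv.rTensor K' (TensorProduct.commIsometry ℂ K H'))).trans
          (TensorProduct.assocIsometry ℂ H' K K'))).trans
      (TensorProduct.assocIsometry ℂ H H' (K ⊗[ℂ] K')).symm)

theorem swapMiddle_tmul {H K H' K' : Type*}
    [NormedAddCommGroup H] [InnerProductSpace ℂ H]
    [NormedAddCommGroup K] [InnerProductSpace ℂ K]
    [NormedAddCommGroup H'] [InnerProductSpace ℂ H']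
    [NormedAddCommGroup K'] [InnerProductSpace ℂ K'] (a : H) (b : K) (c : H') (d : K') :
    swapMiddle H K H' K' ((a ⊗ₜ b) ⊗ₜ (c ⊗ₜ d)) = (a ⊗ₜ c) ⊗ₜ (b ⊗ₜ d) := by
  simp [swapMiddle]

/-- The operator `Φ ⊗ σ`, for `Φ` on `H ⊗ K` and `σ` on `H' ⊗ K'`, with the tensor factors
reordered so that it acts on `(H ⊗ H') ⊗ (K ⊗ K')`. -/
def bipartiteTensor {H K H' K' : Type*}
    [NormedAddCommGroup H] [InnerProductSpace ℂ H]
    [NormedAddCommGroup K] [InnerProductSpace ℂ K]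
    [NormedAddCommGroup H'] [InnerProductSpace ℂ H']
    [NormedAddCommGroup K'] [InnerProductSpace ℂ K']
    (Φ : H ⊗[ℂ] K →L[ℂ] H ⊗[ℂ] K) (σ : H' ⊗[ℂ] K' →L[ℂ] H' ⊗[ℂ] K') :
    (H ⊗[ℂ] H') ⊗[ℂ] (K ⊗[ℂ] K') →L[ℂ] (H ⊗[ℂ] H') ⊗[ℂ] (K ⊗[ℂ] K') :=
  (swapMiddle H K H' K').toContinuousLinearEquiv.toContinuousLinearMap ∘L
    TensorProduct.mapL Φ σ ∘L
    (swapMiddle H K H' K').symm.toContinuousLinearEquiv.toContinuousLinearMap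

end

end SelfTesting

namespace SelfTesting

noncomputable section

open TensorProduct ContinuousLinearMap InnerProductSpace

section Insertion

variable {H K : Type*}
  [NormedAddCommGroup H] [InnerProductSpace ℂ H] [NormedAddCommGroup K] [InnerProductSpace ℂ K]

variable (H) in
/-- The map `x ↦ x ⊗ k`. -/
def tmulRight (k : K) : H →L[ℂ] H ⊗[ℂ] K := (mkL ℂ H K).flip k

@[simp] theorem tmulRight_apply (k : K) (x : H) : tmulRight H k x = x ⊗ₜ k := rfl

variable (K) in
/-- The map `y ↦ h ⊗ y`. -/
def tmulLeft (h : H) : K →L[ℂ] H ⊗[ℂ] K := mkL ℂ H K h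

@[simp] theorem tmulLeft_apply (h : H) (y : K) : tmulLeft K h y = h ⊗ₜ y := rfl

end Insertion

section OperatorCalculus

variable {H K H' K' : Type*}
  [NormedAddCommGroup H] [InnerProductSpace ℂ H] [FiniteDimensional ℂ H]
  [NormedAddCommGroup K] [InnerProductSpace ℂ K] [FiniteDimensional ℂ K]
  [NormedAddCommGroup H'] [InnerProductSpace ℂ H'] [FiniteDimensional ℂ H']
  [NormedAddCommGroup K'] [InnerProductSpace ℂ K'] [FiniteDimensional ℂ K']

/-- Additive properties of operators on `H ⊗ K` may be checked on elementary tensors. -/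
theorem opTensor_induction {p : (H ⊗[ℂ] K →L[ℂ] H ⊗[ℂ] K) → Prop}
    (zero : p 0) (add : ∀ X Y, p X → p Y → p (X + Y))
    (tmul : ∀ (S : H →L[ℂ] H) (T : K →L[ℂ] K), p (mapL S T))
    (X : H ⊗[ℂ] K →L[ℂ] H ⊗[ℂ] K) : p X := by
  obtain ⟨t, rfl⟩ := (opTensorEquiv H K).surjective X
  induction t using TensorProduct.induction_on with
  | zero => rw [LinearEquiv.map_zero]; exact zero
  | tmul S T => rw [opTensorEquiv_tmul]; exact tmul S T
  | add x y hx hy => rw [map_add]; exact add _ _ hx hy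

theorem opTensorEquiv_symm_mapL (S : H →L[ℂ] H) (T : K →L[ℂ] K) :
    (opTensorEquiv H K).symm (mapL S T) = S ⊗ₜ T := by
  rw [LinearEquiv.symm_apply_eq, opTensorEquiv_tmul]

theorem partialTraceRight_mapL (S : H →L[ℂ] H) (T : K →L[ℂ] K) :
    partialTraceRight (mapL S T) = LinearMap.trace ℂ K T.toLinearMap • S := by
  simp only [partialTraceRight, LinearMap.comp_apply, LinearEquiv.coe_coe,
    opTensorEquiv_symm_mapL, TensorProduct.map_tmul, TensorProduct.rid_tmul]
  rfl

theorem partialTraceLeft_mapL (S : H →L[ℂ] H) (T : K →L[ℂ] K) :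
    partialTraceLeft (mapL S T) = LinearMap.trace ℂ H S.toLinearMap • T := by
  simp only [partialTraceLeft, LinearMap.comp_apply, LinearEquiv.coe_coe,
    opTensorEquiv_symm_mapL, TensorProduct.map_tmul, TensorProduct.lid_tmul]
  rfl

theorem channelTensor_mapL (Λ : (H →L[ℂ] H) →ₗ[ℂ] (H' →L[ℂ] H'))
    (Γ : (K →L[ℂ] K) →ₗ[ℂ] (K' →L[ℂ] K')) (S : H →L[ℂ] H) (T : K →L[ℂ] K) :
    channelTensor Λ Γ (mapL S T) = mapL (Λ S) (Γ T) := by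
  simp only [channelTensor, LinearMap.comp_apply, LinearEquiv.coe_coe,
    opTensorEquiv_symm_mapL, TensorProduct.map_tmul, opTensorEquiv_tmul]

theorem trace_mapL (S : H →L[ℂ] H) (T : K →L[ℂ] K) :
    LinearMap.trace ℂ (H ⊗[ℂ] K) (mapL S T).toLinearMap =
      LinearMap.trace ℂ H S.toLinearMap * LinearMap.trace ℂ K T.toLinearMap := by
  rw [toLinearMap_mapL, LinearMap.trace_tensorProduct']

theorem trace_comp_comm_clm (S : H →L[ℂ] K) (T : K →L[ℂ] H) :
    LinearMap.trace ℂ K (S ∘L T).toLinearMap = LinearMap.trace ℂ H (T ∘L S).toLinearMap := by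
  rw [toLinearMap_comp, toLinearMap_comp, LinearMap.trace_comp_comm']

theorem trace_partialTraceRight (X : H ⊗[ℂ] K →L[ℂ] H ⊗[ℂ] K) :
    LinearMap.trace ℂ H (partialTraceRight X).toLinearMap =
      LinearMap.trace ℂ (H ⊗[ℂ] K) X.toLinearMap := by
  induction X using opTensor_induction with
  | zero => simp
  | add X Y hX hY => simp [hX, hY]
  | tmul S T => rw [partialTraceRight_mapL, trace_mapL]; simp [mul_comm]

theorem trace_partialTraceLeft (X : H ⊗[ℂ] K →L[ℂ] H ⊗[ℂ] K) :
    LinearMap.trace ℂ K (partialTraceLeft X).toLinearMap =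
      LinearMap.trace ℂ (H ⊗[ℂ] K) X.toLinearMap := by
  induction X using opTensor_induction with
  | zero => simp
  | add X Y hX hY => simp [hX, hY]
  | tmul S T => rw [partialTraceLeft_mapL, trace_mapL]; simp

theorem partialTraceRight_mapL_comp (P : H →L[ℂ] H) (X : H ⊗[ℂ] K →L[ℂ] H ⊗[ℂ] K) :
    partialTraceRight (mapL P (.id ℂ K) ∘L X) = P ∘L partialTraceRight X := by
  induction X using opTensor_induction with
  | zero => simp
  | add X Y hX hY => simp [hX, hY, comp_add]
  | tmul S T => rw [← mapL_comp, partialTraceRight_mapL, partialTraceRight_mapL]; simp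

theorem partialTraceLeft_mapL_comp (P : K →L[ℂ] K) (X : H ⊗[ℂ] K →L[ℂ] H ⊗[ℂ] K) :
    partialTraceLeft (mapL (.id ℂ H) P ∘L X) = P ∘L partialTraceLeft X := by
  induction X using opTensor_induction with
  | zero => simp
  | add X Y hX hY => simp [hX, hY, comp_add]
  | tmul S T => rw [← mapL_comp, partialTraceLeft_mapL, partialTraceLeft_mapL]; simp

@[simp] theorem adjoint_tmulRight_tmul (k : K) (x : H) (y : K) :
    adjoint (tmulRight H k) (x ⊗ₜ y) = inner ℂ k y • x := by
  refine ext_inner_left ℂ fun v => ?_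
  rw [adjoint_inner_right]
  simp [inner_smul_right, mul_comm]

@[simp] theorem adjoint_tmulLeft_tmul (h : H) (x : H) (y : K) :
    adjoint (tmulLeft K h) (x ⊗ₜ y) = inner ℂ h x • y := by
  refine ext_inner_left ℂ fun v => ?_
  rw [adjoint_inner_right]
  simp [inner_smul_right]

theorem partialTraceRight_eq_sum {ι : Type*} [Fintype ι] (b : OrthonormalBasis ι ℂ K)
    (X : H ⊗[ℂ] K →L[ℂ] H ⊗[ℂ] K) :
    partialTraceRight X = ∑ i, adjoint (tmulRight H (b i)) ∘L X ∘L tmulRight H (b i) := by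
  induction X using opTensor_induction with
  | zero => simp
  | add X Y hX hY => simp [hX, hY, comp_add, add_comp, Finset.sum_add_distrib]
  | tmul S T =>
    rw [partialTraceRight_mapL, LinearMap.trace_eq_sum_inner _ b, Finset.sum_smul]
    refine Finset.sum_congr rfl fun i _ => ?_
    ext x
    simp

theorem comp_eq_zero_of_trace_eq_zero {P R : H →L[ℂ] H} (hP : adjoint P ∘L P = P)
    (hR : R.IsPositive) (h : LinearMap.trace ℂ H (P ∘L R).toLinearMap = 0) : P ∘L R = 0 := by
  obtain ⟨m, u, rfl⟩ := isPositive_iff_eq_sum_rankOne.mp hR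
  have key : ∀ i, inner ℂ (u i) (P (u i)) = ((‖P (u i)‖ ^ 2 : ℝ) : ℂ) := fun i => by
    conv_lhs => rw [← hP, comp_apply, adjoint_inner_right, inner_self_eq_norm_sq_to_K]
    simp
  have hsum : ∑ i, ‖P (u i)‖ ^ 2 = 0 := by
    have : LinearMap.trace ℂ H (P ∘L ∑ i, rankOne ℂ (u i) (u i)).toLinearMap
        = ((∑ i, ‖P (u i)‖ ^ 2 : ℝ) : ℂ) := by
      rw [comp_finsetSum]
      simp only [comp_rankOne, toLinearMap_sum, map_sum, trace_rankOne, key, Complex.ofReal_sum]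
    rw [this] at h
    exact_mod_cast h
  have h0 := (Finset.sum_eq_zero_iff_of_nonneg fun i _ => sq_nonneg _).mp hsum
  rw [comp_finsetSum]
  refine Finset.sum_eq_zero fun i hi => ?_
  have : P (u i) = 0 := by simpa using h0 i hi
  rw [comp_rankOne, this]
  simp

theorem exists_rankOne_of_isDensity_of_pure {Φ : H →L[ℂ] H} (hΦ : IsDensity Φ)
    (h2 : Φ * Φ = Φ) : ∃ φ : H, ‖φ‖ = 1 ∧ Φ = rankOne ℂ φ φ := by
  have hne : Φ ≠ 0 := by
    rintro rfl
    simpa using hΦ.2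
  obtain ⟨x, hx⟩ : ∃ x, Φ x ≠ 0 := by
    by_contra! h
    exact hne (ContinuousLinearMap.ext h)
  set φ : H := ((‖Φ x‖⁻¹ : ℝ) : ℂ) • Φ x with hφ
  have hn : ‖φ‖ = 1 := by
    rw [hφ, norm_smul]
    simp [hx]
  have hfix : Φ φ = φ := by
    rw [hφ, map_smul, ← mul_apply_eq_comp, h2]
  have hsa : adjoint Φ = Φ := hΦ.1.isSelfAdjoint.adjoint_eq
  have h2' : Φ ∘L Φ = Φ := h2
  refine ⟨φ, hn, ?_⟩
  have hrr : rankOne ℂ φ φ ∘L rankOne ℂ φ φ = rankOne ℂ φ φ := by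
    rw [comp_rankOne]; simp [hn]
  have hP : adjoint (Φ - rankOne ℂ φ φ) ∘L (Φ - rankOne ℂ φ φ) = Φ - rankOne ℂ φ φ := by
    rw [map_sub, hsa, adjoint_rankOne, sub_comp, comp_sub, comp_sub, h2', hrr, comp_rankOne,
      rankOne_comp, hsa, hfix]
    abel
  have := comp_eq_zero_of_trace_eq_zero hP (isPositive_one (𝕜 := ℂ) (E := H)) (by
    have h1 : (Φ - rankOne ℂ φ φ) ∘L (1 : H →L[ℂ] H) = Φ - rankOne ℂ φ φ := comp_id _
    rw [h1, toLinearMap_sub, map_sub, hΦ.2, trace_rankOne, inner_self_eq_norm_sq_to_K, hn]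
    simp)
  exact sub_eq_zero.mp this

/-- A positive operator with a pure marginal is a product. -/
theorem exists_eq_mapL_of_partialTraceRight_pure {Φ : H →L[ℂ] H} (hΦ : IsDensity Φ)
    (h2 : Φ * Φ = Φ) {R : H ⊗[ℂ] K →L[ℂ] H ⊗[ℂ] K} (hR : R.IsPositive)
    (h : partialTraceRight R = Φ) :
    ∃ σ : K →L[ℂ] K, IsDensity σ ∧ R = mapL Φ σ := by
  have hsa : adjoint Φ = Φ := hΦ.1.isSelfAdjoint.adjoint_eq
  have h2' : Φ ∘L Φ = Φ := h2
  have hcomp : mapL (.id ℂ H - Φ) (.id ℂ K) ∘L R = 0 := by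
    apply comp_eq_zero_of_trace_eq_zero _ hR
    · rw [← trace_partialTraceRight, partialTraceRight_mapL_comp, h, sub_comp, h2']
      simp
    · rw [adjoint_mapL, ← mapL_comp, map_sub, hsa, adjoint_id, adjoint_id, sub_comp, comp_sub,
        comp_sub, h2']
      simp
  have hl : mapL Φ (.id ℂ K) ∘L R = R := by
    have : mapL (.id ℂ H - Φ) (.id ℂ K) + mapL Φ (.id ℂ K) = .id ℂ (H ⊗[ℂ] K) := by
      rw [← mapL_add_left]; simp
    calc mapL Φ (.id ℂ K) ∘L R
        = (mapL (.id ℂ H - Φ) (.id ℂ K) + mapL Φ (.id ℂ K)) ∘L R := by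
          rw [add_comp, hcomp, zero_add]
      _ = R := by rw [this, id_comp]
  have hr : R ∘L mapL Φ (.id ℂ K) = R := by
    have := congrArg adjoint hl
    rwa [adjoint_comp, adjoint_mapL, hsa, adjoint_id, hR.isSelfAdjoint.adjoint_eq] at this
  obtain ⟨φ, hn, rfl⟩ := exists_rankOne_of_isDensity_of_pure hΦ h2
  have slice : ∀ X : H ⊗[ℂ] K →L[ℂ] H ⊗[ℂ] K,
      mapL (rankOne ℂ φ φ) (.id ℂ K) ∘L X ∘L mapL (rankOne ℂ φ φ) (.id ℂ K) =
        mapL (rankOne ℂ φ φ) (adjoint (tmulLeft K φ) ∘L X ∘L tmulLeft K φ) := by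
    intro X
    induction X using opTensor_induction with
    | zero => simp
    | add X Y hX hY => simp only [add_comp, comp_add, mapL_add_right, hX, hY]
    | tmul S T =>
      have h1 : adjoint (tmulLeft K φ) ∘L mapL S T ∘L tmulLeft K φ = inner ℂ φ (S φ) • T := by
        ext y; simp
      rw [h1, ← mapL_comp, ← mapL_comp, comp_rankOne, comp_rankOne, mapL_smul_right,
        ← mapL_smul_left]
      simp
  have hRσ := slice R
  rw [hr, hl] at hRσ
  refine ⟨_, ⟨hR.adjoint_conj (tmulLeft K φ), ?_⟩, hRσ⟩
  have ht := trace_mapL (rankOne ℂ φ φ) (adjoint (tmulLeft K φ) ∘L R ∘L tmulLeft K φ)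
  rwa [← hRσ, hΦ.2, one_mul, ← trace_partialTraceRight, h, hΦ.2, eq_comm] at ht

end OperatorCalculus

section Kraus

theorem nonneg_exists_star_mul_self {A : Type*} [NonUnitalCStarAlgebra A] [PartialOrder A]
    [StarOrderedRing A] {a : A} (ha : 0 ≤ a) : ∃ b, a = star b * b :=
  CStarAlgebra.nonneg_iff_eq_star_mul_self.mp ha

/-- The square `C⋆`-matrix with the given entries. -/
def cstarOf {A : Type*} {n : ℕ} (f : Fin n → Fin n → A) : CStarMatrix (Fin n) (Fin n) A :=
  CStarMatrix.ofMatrix (Matrix.of f)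

@[simp] theorem cstarOf_apply {A : Type*} {n : ℕ} (f : Fin n → Fin n → A) (i j : Fin n) :
    cstarOf f i j = f i j := rfl

theorem cstarMatrix_sum_apply {A κ : Type*} [AddCommMonoid A] [Fintype κ] {n : ℕ}
    (f : κ → CStarMatrix (Fin n) (Fin n) A) (i j : Fin n) :
    (∑ k, f k) i j = ∑ k, f k i j :=
  Matrix.sum_apply i j Finset.univ f

theorem cstarOf_star_mul_nonneg {A : Type*} [CStarAlgebra A] [PartialOrder A]
    [StarOrderedRing A] {n : ℕ} (r : Fin n → A) :
    0 ≤ cstarOf fun i j => star (r i) * r j := by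
  cases n with
  | zero => exact le_of_eq (CStarMatrix.ext fun i => i.elim0)
  | succ n =>
    have : (cstarOf fun i j => star (r i) * r j) =
        star (cstarOf fun k j => if k = 0 then r j else 0) *
          cstarOf fun k j => if k = 0 then r j else 0 := by
      refine CStarMatrix.ext fun i j => ?_
      rw [CStarMatrix.mul_apply, Finset.sum_eq_single 0]
      · simp [CStarMatrix.star_apply]
      · intro k _ hk
        simp [CStarMatrix.star_apply, hk]
      · simp
    rw [this]
    exact star_mul_self_nonneg _

variable {H K : Type*}
  [NormedAddCommGroup H] [InnerProductSpace ℂ H] [FiniteDimensional ℂ H]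
  [NormedAddCommGroup K] [InnerProductSpace ℂ K] [FiniteDimensional ℂ K]

/-- The linear map `X ↦ ∑ a, M a ∘ X ∘ (M a)†`. -/
def krausMap {ι : Type*} [Fintype ι] (M : ι → H →L[ℂ] K) : (H →L[ℂ] H) →ₗ[ℂ] (K →L[ℂ] K) where
  toFun X := ∑ a, M a ∘L X ∘L adjoint (M a)
  map_add' X Y := by simp only [add_comp, comp_add, Finset.sum_add_distrib]
  map_smul' c X := by simp only [smul_comp, comp_smul, Finset.smul_sum, RingHom.id_apply]

theorem krausMap_apply {ι : Type*} [Fintype ι] (M : ι → H →L[ℂ] K) (X : H →L[ℂ] H) :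
    krausMap M X = ∑ a, M a ∘L X ∘L adjoint (M a) := rfl

theorem cstarOf_adjoint_comp_nonneg {n : ℕ} (T : Fin n → K →L[ℂ] H) :
    0 ≤ cstarOf fun i j => adjoint (T i) ∘L T j := by
  rcases subsingleton_or_nontrivial K with hK | hK
  · refine le_of_eq (CStarMatrix.ext fun i j => ?_)
    exact Subsingleton.elim _ _
  obtain ⟨u, hu⟩ := exists_norm_eq K zero_le_one
  set b := stdOrthonormalBasis ℂ H
  have : (cstarOf fun i j => adjoint (T i) ∘L T j) = ∑ h, cstarOf fun i j =>
        star (rankOne ℂ u (b h) ∘L T i) * (rankOne ℂ u (b h) ∘L T j) := by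
    refine CStarMatrix.ext fun i j => ?_
    simp only [cstarMatrix_sum_apply, cstarOf_apply]
    calc adjoint (T i) ∘L T j = adjoint (T i) ∘L (∑ h, rankOne ℂ (b h) (b h)) ∘L T j := by
          rw [b.sum_rankOne_eq_id, id_comp]
      _ = ∑ h, adjoint (T i) ∘L rankOne ℂ (b h) (b h) ∘L T j := by
          rw [finsetSum_comp, comp_finsetSum]
      _ = _ := by
          refine Finset.sum_congr rfl fun h _ => ?_
          have : rankOne ℂ (b h) u ∘L rankOne ℂ u (b h) = rankOne ℂ (b h) (b h) := by
            rw [comp_rankOne]; simp [hu]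
          rw [star_eq_adjoint, adjoint_comp, adjoint_rankOne, mul_def, ← this]
          simp only [comp_assoc]
  rw [this]
  exact Finset.sum_nonneg fun h _ => cstarOf_star_mul_nonneg _

theorem krausMap_map_nonneg {ι : Type*} [Fintype ι] (M : ι → H →L[ℂ] K) (n : ℕ)
    (N : CStarMatrix (Fin n) (Fin n) (H →L[ℂ] H)) (hN : 0 ≤ N) : 0 ≤ N.map (krausMap M) := by
  obtain ⟨Y, rfl⟩ := nonneg_exists_star_mul_self hN
  have : (star Y * Y).map (krausMap M) = ∑ a, ∑ k, cstarOf fun i j =>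
      adjoint (Y k i ∘L adjoint (M a)) ∘L (Y k j ∘L adjoint (M a)) := by
    refine CStarMatrix.ext fun i j => ?_
    rw [cstarMatrix_sum_apply, CStarMatrix.map_apply, CStarMatrix.mul_apply, krausMap_apply]
    refine Finset.sum_congr rfl fun a _ => ?_
    rw [cstarMatrix_sum_apply, finsetSum_comp, comp_finsetSum]
    refine Finset.sum_congr rfl fun k _ => ?_
    rw [CStarMatrix.star_apply, cstarOf_apply, adjoint_comp, adjoint_adjoint,
      star_eq_adjoint, mul_def]
    simp only [comp_assoc]
  rw [this]
  exact Finset.sum_nonneg fun a _ => Finset.sum_nonneg fun k _ =>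
    cstarOf_adjoint_comp_nonneg _

/-- A map in Kraus form is completely positive. -/
def krausCP {ι : Type*} [Fintype ι] (M : ι → H →L[ℂ] K) : (H →L[ℂ] H) →CP (K →L[ℂ] K) where
  toLinearMap := krausMap M
  map_cstarMatrix_nonneg' := krausMap_map_nonneg M

theorem clm_induction_rankOne {ι : Type*} [Fintype ι] (b : OrthonormalBasis ι ℂ H)
    {M : Type*} [AddCommMonoid M] [Module ℂ M] {f g : (H →L[ℂ] H) →ₗ[ℂ] M}
    (h : ∀ i j, f (rankOne ℂ (b i) (b j)) = g (rankOne ℂ (b i) (b j))) : f = g := by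
  ext X
  have hX : X = ∑ j, ∑ i, inner ℂ (b i) (X (b j)) • rankOne ℂ (b i) (b j) := by
    calc X = X ∘L ∑ j, rankOne ℂ (b j) (b j) := by rw [b.sum_rankOne_eq_id, comp_id]
      _ = ∑ j, rankOne ℂ (X (b j)) (b j) := by simp only [comp_finsetSum, comp_rankOne]
      _ = _ := by
          refine Finset.sum_congr rfl fun j _ => ?_
          conv_lhs => rw [← b.sum_repr' (X (b j))]
          simp
  rw [hX]
  simp only [map_sum, map_smul, h]

/-- Every completely positive map has a Kraus form. -/
theorem exists_kraus (Λ : (H →L[ℂ] H) →CP (K →L[ℂ] K)) :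
    ∃ M : Fin (Module.finrank ℂ H) × Fin (Module.finrank ℂ K) → H →L[ℂ] K,
      Λ.toLinearMap = krausMap M := by
  rcases subsingleton_or_nontrivial H with hH | hH
  · refine ⟨fun _ => 0, ?_⟩
    ext1 X
    rw [Subsingleton.elim X 0, map_zero, map_zero]
  obtain ⟨u, hu⟩ := exists_norm_eq H zero_le_one
  set b := stdOrthonormalBasis ℂ H
  set f := stdOrthonormalBasis ℂ K
  have hpos := CompletelyPositiveMap.map_cstarMatrix_nonneg' Λ _ _
    (cstarOf_star_mul_nonneg fun i => rankOne ℂ u (b i))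
  obtain ⟨Y, hY⟩ := nonneg_exists_star_mul_self hpos
  have hΛ : ∀ i j, Λ.toLinearMap (rankOne ℂ (b i) (b j)) = ∑ k, adjoint (Y k i) ∘L Y k j := by
    intro i j
    have h := congrFun (congrFun hY i) j
    rw [CStarMatrix.map_apply, cstarOf_apply, CStarMatrix.mul_apply,
      star_eq_adjoint, adjoint_rankOne, mul_def, comp_rankOne, rankOne_apply,
      inner_self_eq_norm_sq_to_K, hu] at h
    simpa [CStarMatrix.star_apply, star_eq_adjoint, mul_def] using h
  refine ⟨fun p => ∑ i, rankOne ℂ (adjoint (Y p.1 i) (f p.2)) (b i), ?_⟩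
  refine clm_induction_rankOne b fun i j => ?_
  have hb : ∀ (p : Fin (Module.finrank ℂ H) × Fin (Module.finrank ℂ K)) i,
      (∑ i, rankOne ℂ (adjoint (Y p.1 i) (f p.2)) (b i)) (b i) =
        adjoint (Y p.1 i) (f p.2) := by
    intro p i
    simp only [sum_apply, rankOne_apply, b.inner_eq_ite]
    simp
  rw [hΛ, krausMap_apply, Fintype.sum_prod_type]
  refine Finset.sum_congr rfl fun k _ => ?_
  calc adjoint (Y k i) ∘L Y k j = adjoint (Y k i) ∘L (∑ m, rankOne ℂ (f m) (f m)) ∘L Y k j := by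
        rw [f.sum_rankOne_eq_id, id_comp]
    _ = _ := by
        rw [finsetSum_comp, comp_finsetSum]
        refine Finset.sum_congr rfl fun m _ => ?_
        rw [rankOne_comp, comp_rankOne, rankOne_comp, comp_rankOne, adjoint_adjoint]
        have h1 := hb (k, m) i
        have h2 := hb (k, m) j
        simp only at h1 h2
        rw [h1, h2]

/-- Stinespring dilation of a quantum channel. -/
theorem exists_stinespring.{u} (Λ : (H →L[ℂ] H) →CP (K →L[ℂ] K))
    (hΛ : IsTracePreserving Λ.toLinearMap) :
    ∃ (ι : Type u) (_ : Fintype ι) (V : H →ₗᵢ[ℂ] K ⊗[ℂ] EuclideanSpace ℂ ι),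
      ∀ X, Λ.toLinearMap X = partialTraceRight (conjIsometry V X) := by
  obtain ⟨M, hM⟩ := exists_kraus Λ
  let ι := ULift.{u} (Fin (Module.finrank ℂ H) × Fin (Module.finrank ℂ K))
  let g := EuclideanSpace.basisFun ι ℂ
  let V : H →L[ℂ] K ⊗[ℂ] EuclideanSpace ℂ ι := ∑ a : ι, tmulRight K (g a) ∘L M a.down
  have hVM : ∀ a, adjoint (tmulRight K (g a)) ∘L V = M a.down := by
    intro a
    ext x
    simp only [V, comp_apply, sum_apply, map_sum, tmulRight_apply, adjoint_tmulRight_tmul,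
      g.inner_eq_ite]
    simp
  have hptr : ∀ X, Λ.toLinearMap X = partialTraceRight (V ∘L X ∘L adjoint V) := by
    intro X
    rw [hM, krausMap_apply, partialTraceRight_eq_sum g, ← Equiv.ulift.sum_comp]
    refine Finset.sum_congr rfl fun a _ => ?_
    rw [show M (Equiv.ulift a) = M a.down from rfl, ← hVM a, adjoint_comp, adjoint_adjoint]
    simp only [comp_assoc]
  have hnorm : ∀ x, ‖V x‖ = ‖x‖ := by
    intro x
    have h := hΛ (rankOne ℂ x x)
    rw [hptr, trace_partialTraceRight, rankOne_comp, comp_rankOne, trace_rankOne, trace_rankOne,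
      adjoint_adjoint, inner_self_eq_norm_sq_to_K, inner_self_eq_norm_sq_to_K] at h
    have h' : ‖V x‖ ^ 2 = ‖x‖ ^ 2 := by exact_mod_cast h
    exact (pow_left_inj₀ (norm_nonneg _) (norm_nonneg _) two_ne_zero).mp h'
  exact ⟨ι, inferInstance, ⟨V.toLinearMap, hnorm⟩, hptr⟩

end Kraus

section Swap

variable {H K H' K' : Type*}
  [NormedAddCommGroup H] [InnerProductSpace ℂ H] [NormedAddCommGroup K] [InnerProductSpace ℂ K]
  [NormedAddCommGroup H'] [InnerProductSpace ℂ H'] [NormedAddCommGroup K'] [InnerProductSpace ℂ K']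

variable (H K H' K') in
/-- `swapMiddle` as a continuous linear map. -/
def swapL : (H ⊗[ℂ] K) ⊗[ℂ] (H' ⊗[ℂ] K') →L[ℂ] (H ⊗[ℂ] H') ⊗[ℂ] (K ⊗[ℂ] K') :=
  (swapMiddle H K H' K').toContinuousLinearEquiv.toContinuousLinearMap

variable (H K H' K') in
/-- The inverse of `swapL`. -/
def swapSymmL : (H ⊗[ℂ] H') ⊗[ℂ] (K ⊗[ℂ] K') →L[ℂ] (H ⊗[ℂ] K) ⊗[ℂ] (H' ⊗[ℂ] K') :=
  (swapMiddle H K H' K').symm.toContinuousLinearEquiv.toContinuousLinearMap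

theorem swapL_tmul (a : H) (b : K) (c : H') (d : K') :
    swapL H K H' K' ((a ⊗ₜ b) ⊗ₜ (c ⊗ₜ d)) = (a ⊗ₜ c) ⊗ₜ (b ⊗ₜ d) :=
  swapMiddle_tmul a b c d

theorem swapSymmL_tmul (a : H) (b : K) (c : H') (d : K') :
    swapSymmL H K H' K' ((a ⊗ₜ c) ⊗ₜ (b ⊗ₜ d)) = (a ⊗ₜ b) ⊗ₜ (c ⊗ₜ d) :=
  (swapMiddle H K H' K').symm_apply_eq.mpr (swapMiddle_tmul a b c d).symm

theorem norm_swapL (x : (H ⊗[ℂ] K) ⊗[ℂ] (H' ⊗[ℂ] K')) :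
    ‖swapL H K H' K' x‖ = ‖x‖ := (swapMiddle H K H' K').norm_map x

theorem swapL_swapSymmL (x : (H ⊗[ℂ] H') ⊗[ℂ] (K ⊗[ℂ] K')) :
    swapL H K H' K' (swapSymmL H K H' K' x) = x := (swapMiddle H K H' K').apply_symm_apply x

theorem swapSymmL_comp_swapL : swapSymmL H K H' K' ∘L swapL H K H' K' = .id ℂ _ := by
  ext1 x
  exact (swapMiddle H K H' K').symm_apply_apply x

theorem swapL_comp_swapSymmL : swapL H K H' K' ∘L swapSymmL H K H' K' = .id ℂ _ := by
  ext1 x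
  exact swapL_swapSymmL x

theorem bipartiteTensor_eq (Φ : H ⊗[ℂ] K →L[ℂ] H ⊗[ℂ] K) (σ : H' ⊗[ℂ] K' →L[ℂ] H' ⊗[ℂ] K') :
    bipartiteTensor Φ σ = swapL H K H' K' ∘L mapL Φ σ ∘L swapSymmL H K H' K' := by
  rfl

theorem eq_bipartiteTensor_iff {Φ : H ⊗[ℂ] K →L[ℂ] H ⊗[ℂ] K}
    {σ : H' ⊗[ℂ] K' →L[ℂ] H' ⊗[ℂ] K'}
    {Y : (H ⊗[ℂ] H') ⊗[ℂ] (K ⊗[ℂ] K') →L[ℂ] (H ⊗[ℂ] H') ⊗[ℂ] (K ⊗[ℂ] K')} :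
    Y = bipartiteTensor Φ σ ↔
      swapSymmL H K H' K' ∘L Y ∘L swapL H K H' K' = mapL Φ σ := by
  rw [bipartiteTensor_eq]
  constructor
  · rintro rfl
    rw [comp_assoc, comp_assoc, swapSymmL_comp_swapL, comp_id, ← comp_assoc, swapSymmL_comp_swapL,
      id_comp]
  · intro h
    rw [← h, comp_assoc, comp_assoc, swapL_comp_swapSymmL, comp_id, ← comp_assoc,
      swapL_comp_swapSymmL, id_comp]

theorem swapL_comp_mapL {A B C D : Type*}
    [NormedAddCommGroup A] [InnerProductSpace ℂ A]
    [NormedAddCommGroup B] [InnerProductSpace ℂ B]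
    [NormedAddCommGroup C] [InnerProductSpace ℂ C]
    [NormedAddCommGroup D] [InnerProductSpace ℂ D]
    (S : A →L[ℂ] H) (T : B →L[ℂ] K) (S' : C →L[ℂ] H') (T' : D →L[ℂ] K') :
    swapL H K H' K' ∘L mapL (mapL S T) (mapL S' T') =
      mapL (mapL S S') (mapL T T') ∘L swapL A B C D := by
  rw [← ContinuousLinearMap.coe_inj]
  refine TensorProduct.ext_fourfold' fun a b c d => ?_
  simp [swapL_tmul]

theorem swapSymmL_comp_mapL {A B C D : Type*}
    [NormedAddCommGroup A] [InnerProductSpace ℂ A]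
    [NormedAddCommGroup B] [InnerProductSpace ℂ B]
    [NormedAddCommGroup C] [InnerProductSpace ℂ C]
    [NormedAddCommGroup D] [InnerProductSpace ℂ D]
    (S : A →L[ℂ] H) (T : B →L[ℂ] K) (S' : C →L[ℂ] H') (T' : D →L[ℂ] K') :
    swapSymmL H K H' K' ∘L mapL (mapL S S') (mapL T T') =
      mapL (mapL S T) (mapL S' T') ∘L swapSymmL A B C D := by
  rw [← ContinuousLinearMap.coe_inj]
  refine TensorProduct.ext_fourfold' fun a b c d => ?_
  simp [swapSymmL_tmul]

theorem bipartiteTensor_mapL (S : H →L[ℂ] H) (T : K →L[ℂ] K) (S' : H' →L[ℂ] H')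
    (T' : K' →L[ℂ] K') :
    bipartiteTensor (mapL S T) (mapL S' T') = mapL (mapL S S') (mapL T T') := by
  rw [bipartiteTensor_eq, ← comp_assoc, swapL_comp_mapL, comp_assoc, swapL_comp_swapSymmL, comp_id]

theorem bipartiteTensor_add_left (Φ Ψ : H ⊗[ℂ] K →L[ℂ] H ⊗[ℂ] K)
    (σ : H' ⊗[ℂ] K' →L[ℂ] H' ⊗[ℂ] K') :
    bipartiteTensor (Φ + Ψ) σ = bipartiteTensor Φ σ + bipartiteTensor Ψ σ := by
  simp only [bipartiteTensor_eq, mapL_add_left, add_comp, comp_add]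

theorem bipartiteTensor_add_right (Φ : H ⊗[ℂ] K →L[ℂ] H ⊗[ℂ] K)
    (σ τ : H' ⊗[ℂ] K' →L[ℂ] H' ⊗[ℂ] K') :
    bipartiteTensor Φ (σ + τ) = bipartiteTensor Φ σ + bipartiteTensor Φ τ := by
  simp only [bipartiteTensor_eq, mapL_add_right, add_comp, comp_add]

theorem bipartiteTensor_zero_left (σ : H' ⊗[ℂ] K' →L[ℂ] H' ⊗[ℂ] K') :
    bipartiteTensor (0 : H ⊗[ℂ] K →L[ℂ] H ⊗[ℂ] K) σ = 0 := by
  rw [bipartiteTensor_eq, mapL_zero_left, zero_comp, comp_zero]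

theorem bipartiteTensor_zero_right (Φ : H ⊗[ℂ] K →L[ℂ] H ⊗[ℂ] K) :
    bipartiteTensor Φ (0 : H' ⊗[ℂ] K' →L[ℂ] H' ⊗[ℂ] K') = 0 := by
  rw [bipartiteTensor_eq, mapL_zero_right, zero_comp, comp_zero]

end Swap

section Bipartite

variable {H K H' K' : Type*}
  [NormedAddCommGroup H] [InnerProductSpace ℂ H] [FiniteDimensional ℂ H]
  [NormedAddCommGroup K] [InnerProductSpace ℂ K] [FiniteDimensional ℂ K]
  [NormedAddCommGroup H'] [InnerProductSpace ℂ H'] [FiniteDimensional ℂ H']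
  [NormedAddCommGroup K'] [InnerProductSpace ℂ K'] [FiniteDimensional ℂ K']

theorem isPositive_conj_of_norm_map {A B : Type*} [NormedAddCommGroup A] [InnerProductSpace ℂ A]
    [CompleteSpace A] [NormedAddCommGroup B] [InnerProductSpace ℂ B] [CompleteSpace B]
    (S : A →L[ℂ] B) (S' : B →L[ℂ] A) (hS : ∀ x, ‖S x‖ = ‖x‖) (hS' : ∀ y, S (S' y) = y)
    {X : B →L[ℂ] B} (hX : X.IsPositive) : (S' ∘L X ∘L S).IsPositive := by
  have : S' = adjoint S := by
    ext y
    refine ext_inner_left ℂ fun x => ?_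
    rw [adjoint_inner_right]
    conv_rhs => rw [← hS' y]
    exact ((LinearIsometry.mk S.toLinearMap hS).inner_map_map x _).symm
  rw [this]
  exact hX.adjoint_conj S

theorem isPositive_swapSymmL_conj
    {X : (H ⊗[ℂ] H') ⊗[ℂ] (K ⊗[ℂ] K') →L[ℂ] (H ⊗[ℂ] H') ⊗[ℂ] (K ⊗[ℂ] K')}
    (hX : IsPositive (𝕜 := ℂ) (E := (H ⊗[ℂ] H') ⊗[ℂ] (K ⊗[ℂ] K')) X) :
    IsPositive (𝕜 := ℂ) (E := (H ⊗[ℂ] K) ⊗[ℂ] (H' ⊗[ℂ] K'))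
      (swapSymmL H K H' K' ∘L X ∘L swapL H K H' K') := by
  have h := isPositive_conj_of_norm_map (A := (H ⊗[ℂ] K) ⊗[ℂ] (H' ⊗[ℂ] K'))
    (B := (H ⊗[ℂ] H') ⊗[ℂ] (K ⊗[ℂ] K')) (swapL H K H' K') (swapSymmL H K H' K')
    ?_ ?_ hX
  · exact h
  · intro x
    exact norm_swapL x
  · intro x
    exact swapL_swapSymmL x

theorem partialTraceRight_bipartiteTensor (Φ : H ⊗[ℂ] K →L[ℂ] H ⊗[ℂ] K)
    (σ : H' ⊗[ℂ] K' →L[ℂ] H' ⊗[ℂ] K') :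
    partialTraceRight (bipartiteTensor Φ σ) =
      mapL (partialTraceRight Φ) (partialTraceRight σ) := by
  induction Φ using opTensor_induction with
  | zero => rw [bipartiteTensor_zero_left, map_zero, map_zero, mapL_zero_left]
  | add X Y hX hY => rw [bipartiteTensor_add_left, map_add, hX, hY, map_add, mapL_add_left]
  | tmul S T =>
    induction σ using opTensor_induction with
    | zero => rw [bipartiteTensor_zero_right, map_zero, map_zero, mapL_zero_right]
    | add X Y hX hY => rw [bipartiteTensor_add_right, map_add, hX, hY, map_add, mapL_add_right]
    | tmul S' T' =>
      simp only [bipartiteTensor_mapL, partialTraceRight_mapL, trace_mapL, mapL_smul_left,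
        mapL_smul_right, smul_smul, mul_comm]

theorem partialTraceLeft_bipartiteTensor (Φ : H ⊗[ℂ] K →L[ℂ] H ⊗[ℂ] K)
    (σ : H' ⊗[ℂ] K' →L[ℂ] H' ⊗[ℂ] K') :
    partialTraceLeft (bipartiteTensor Φ σ) =
      mapL (partialTraceLeft Φ) (partialTraceLeft σ) := by
  induction Φ using opTensor_induction with
  | zero => rw [bipartiteTensor_zero_left, map_zero, map_zero, mapL_zero_left]
  | add X Y hX hY => rw [bipartiteTensor_add_left, map_add, hX, hY, map_add, mapL_add_left]
  | tmul S T =>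
    induction σ using opTensor_induction with
    | zero => rw [bipartiteTensor_zero_right, map_zero, map_zero, mapL_zero_right]
    | add X Y hX hY => rw [bipartiteTensor_add_right, map_add, hX, hY, map_add, mapL_add_right]
    | tmul S' T' =>
      simp only [bipartiteTensor_mapL, partialTraceLeft_mapL, trace_mapL, mapL_smul_left,
        mapL_smul_right, smul_smul, mul_comm]

/-- Tracing out both auxiliary systems locally amounts to a single partial trace after
reordering the tensor factors. -/
theorem channelTensor_partialTraceRight
    (Y : (H ⊗[ℂ] H') ⊗[ℂ] (K ⊗[ℂ] K') →L[ℂ] (H ⊗[ℂ] H') ⊗[ℂ] (K ⊗[ℂ] K')) :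
    channelTensor partialTraceRight partialTraceRight Y =
      partialTraceRight (swapSymmL H K H' K' ∘L Y ∘L swapL H K H' K') := by
  induction Y using opTensor_induction with
  | zero => simp
  | add X Y hX hY => simp only [map_add, hX, hY, add_comp, comp_add]
  | tmul X Z =>
    rw [channelTensor_mapL]
    induction X using opTensor_induction with
    | zero => simp
    | add X X' hX hX' => simp only [map_add, mapL_add_left, hX, hX', add_comp, comp_add]
    | tmul S S' =>
      induction Z using opTensor_induction with
      | zero => simp
      | add Z Z' hZ hZ' => simp only [map_add, mapL_add_right, hZ, hZ', add_comp, comp_add]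
      | tmul T T' =>
        rw [eq_bipartiteTensor_iff.mp (bipartiteTensor_mapL S T S' T').symm]
        simp only [partialTraceRight_mapL, trace_mapL, mapL_smul_left, mapL_smul_right, smul_smul,
          mul_comm]

end Bipartite

section Isometry

variable {H K H' K' E F : Type*}
  [NormedAddCommGroup H] [InnerProductSpace ℂ H] [FiniteDimensional ℂ H]
  [NormedAddCommGroup K] [InnerProductSpace ℂ K] [FiniteDimensional ℂ K]
  [NormedAddCommGroup H'] [InnerProductSpace ℂ H'] [FiniteDimensional ℂ H']
  [NormedAddCommGroup K'] [InnerProductSpace ℂ K'] [FiniteDimensional ℂ K']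
  [NormedAddCommGroup E] [InnerProductSpace ℂ E] [FiniteDimensional ℂ E]
  [NormedAddCommGroup F] [InnerProductSpace ℂ F] [FiniteDimensional ℂ F]

theorem adjoint_comp_isometry (V : H →ₗᵢ[ℂ] K) :
    adjoint V.toContinuousLinearMap ∘L V.toContinuousLinearMap = .id ℂ H := by
  refine ContinuousLinearMap.ext fun x => ext_inner_left ℂ fun y => ?_
  rw [comp_apply, adjoint_inner_right]
  exact V.inner_map_map y x

theorem conjIsometry_mapL (V : H →ₗᵢ[ℂ] H') (W : K →ₗᵢ[ℂ] K') (S : H →L[ℂ] H) (T : K →L[ℂ] K) :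
    conjIsometry (mapIsometry V W) (mapL S T) = mapL (conjIsometry V S) (conjIsometry W T) := by
  simp only [conjIsometry, toContinuousLinearMap_mapIsometry, adjoint_mapL, mapL_comp]

theorem conjIsometry_add (V : H →ₗᵢ[ℂ] K) (S T : H →L[ℂ] H) :
    conjIsometry V (S + T) = conjIsometry V S + conjIsometry V T := by
  simp only [conjIsometry, add_comp, comp_add]

theorem conjIsometry_zero (V : H →ₗᵢ[ℂ] K) : conjIsometry V (0 : H →L[ℂ] H) = 0 := by
  simp only [conjIsometry, zero_comp, comp_zero]

theorem conjIsometry_injective (V : H →ₗᵢ[ℂ] K) :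
    Function.Injective (conjIsometry V : (H →L[ℂ] H) → (K →L[ℂ] K)) := by
  refine Function.LeftInverse.injective
    (g := fun Y => adjoint V.toContinuousLinearMap ∘L Y ∘L V.toContinuousLinearMap) fun X => ?_
  simp only [conjIsometry, comp_assoc, adjoint_comp_isometry, comp_id]
  rw [← comp_assoc, adjoint_comp_isometry, id_comp]

theorem channelTensor_conjIsometry (V : H →ₗᵢ[ℂ] H') (W : K →ₗᵢ[ℂ] K')
    {Λ : (H' →L[ℂ] H') →ₗ[ℂ] (E →L[ℂ] E)} {Λ' : (H →L[ℂ] H) →ₗ[ℂ] (E →L[ℂ] E)}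
    {Γ : (K' →L[ℂ] K') →ₗ[ℂ] (F →L[ℂ] F)} {Γ' : (K →L[ℂ] K) →ₗ[ℂ] (F →L[ℂ] F)}
    (hΛ : ∀ X, Λ (conjIsometry V X) = Λ' X) (hΓ : ∀ X, Γ (conjIsometry W X) = Γ' X)
    (X : H ⊗[ℂ] K →L[ℂ] H ⊗[ℂ] K) :
    channelTensor Λ Γ (conjIsometry (mapIsometry V W) X) = channelTensor Λ' Γ' X := by
  induction X using opTensor_induction with
  | zero => rw [conjIsometry_zero, map_zero, map_zero]
  | add X Y hX hY => rw [conjIsometry_add, map_add, hX, hY, map_add]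
  | tmul S T => rw [conjIsometry_mapL, channelTensor_mapL, channelTensor_mapL, hΛ, hΓ]

theorem conjIsometry_mapIsometry_comp {G G' : Type*}
    [NormedAddCommGroup G] [InnerProductSpace ℂ G] [FiniteDimensional ℂ G]
    [NormedAddCommGroup G'] [InnerProductSpace ℂ G'] [FiniteDimensional ℂ G']
    (V : H →ₗᵢ[ℂ] H') (W : K →ₗᵢ[ℂ] K') (V' : G →ₗᵢ[ℂ] H) (W' : G' →ₗᵢ[ℂ] K)
    (X : G ⊗[ℂ] G' →L[ℂ] G ⊗[ℂ] G') :
    conjIsometry (mapIsometry (V.comp V') (W.comp W')) X =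
      conjIsometry (mapIsometry V W) (conjIsometry (mapIsometry V' W') X) := by
  have hV : (V.comp V').toContinuousLinearMap =
      V.toContinuousLinearMap ∘L V'.toContinuousLinearMap := rfl
  have hW : (W.comp W').toContinuousLinearMap =
      W.toContinuousLinearMap ∘L W'.toContinuousLinearMap := rfl
  simp only [conjIsometry, toContinuousLinearMap_mapIsometry, hV, hW, mapL_comp, adjoint_comp,
    comp_assoc]

theorem bipartiteTensor_conjIsometry (V : E →ₗᵢ[ℂ] H') (W : F →ₗᵢ[ℂ] K')
    (Φ : H ⊗[ℂ] K →L[ℂ] H ⊗[ℂ] K) (τ : E ⊗[ℂ] F →L[ℂ] E ⊗[ℂ] F) :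
    bipartiteTensor Φ (conjIsometry (mapIsometry V W) τ) =
      conjIsometry (mapIsometry (mapIsometry LinearIsometry.id V)
        (mapIsometry LinearIsometry.id W)) (bipartiteTensor Φ τ) := by
  have h := swapL_comp_mapL (.id ℂ H) (.id ℂ K) V.toContinuousLinearMap W.toContinuousLinearMap
  have h' := swapSymmL_comp_mapL (.id ℂ H) (.id ℂ K) (adjoint V.toContinuousLinearMap)
    (adjoint W.toContinuousLinearMap)
  have hid : (LinearIsometry.id : H →ₗᵢ[ℂ] H).toContinuousLinearMap = .id ℂ H := rfl
  have hid' : (LinearIsometry.id : K →ₗᵢ[ℂ] K).toContinuousLinearMap = .id ℂ K := rfl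
  rw [bipartiteTensor_eq, bipartiteTensor_eq]
  simp only [conjIsometry, toContinuousLinearMap_mapIsometry, adjoint_mapL, hid, hid', adjoint_id]
  have key : mapL Φ (mapL V.toContinuousLinearMap W.toContinuousLinearMap ∘L τ ∘L
        mapL (adjoint V.toContinuousLinearMap) (adjoint W.toContinuousLinearMap)) =
      mapL (mapL (.id ℂ H) (.id ℂ K)) (mapL V.toContinuousLinearMap W.toContinuousLinearMap) ∘L
        mapL Φ τ ∘L mapL (mapL (.id ℂ H) (.id ℂ K))
          (mapL (adjoint V.toContinuousLinearMap) (adjoint W.toContinuousLinearMap)) := by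
    rw [mapL_id_id, ← mapL_comp, ← mapL_comp, id_comp, comp_id]
  rw [key]
  simp only [comp_assoc]
  rw [h', ← comp_assoc, h]
  simp only [comp_assoc]

theorem isPositive_conjIsometry (V : H →ₗᵢ[ℂ] K) {X : H →L[ℂ] H} (hX : X.IsPositive) :
    (conjIsometry V X).IsPositive :=
  hX.conj_adjoint V.toContinuousLinearMap

theorem range_comp_partialTraceRight (V : H →ₗᵢ[ℂ] H') (W : K →ₗᵢ[ℂ] K')
    (X : H ⊗[ℂ] K →L[ℂ] H ⊗[ℂ] K) :
    (V.toContinuousLinearMap ∘L adjoint V.toContinuousLinearMap) ∘L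
      partialTraceRight (conjIsometry (mapIsometry V W) X) =
        partialTraceRight (conjIsometry (mapIsometry V W) X) := by
  rw [← partialTraceRight_mapL_comp, conjIsometry, ← comp_assoc,
    toContinuousLinearMap_mapIsometry, ← mapL_comp, comp_assoc, adjoint_comp_isometry, comp_id,
    id_comp]

theorem range_comp_partialTraceLeft (V : H →ₗᵢ[ℂ] H') (W : K →ₗᵢ[ℂ] K')
    (X : H ⊗[ℂ] K →L[ℂ] H ⊗[ℂ] K) :
    (W.toContinuousLinearMap ∘L adjoint W.toContinuousLinearMap) ∘L
      partialTraceLeft (conjIsometry (mapIsometry V W) X) =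
        partialTraceLeft (conjIsometry (mapIsometry V W) X) := by
  rw [← partialTraceLeft_mapL_comp, conjIsometry, ← comp_assoc,
    toContinuousLinearMap_mapIsometry, ← mapL_comp, comp_assoc, adjoint_comp_isometry, comp_id,
    id_comp]

theorem trace_conjIsometry (V : H →ₗᵢ[ℂ] K) (X : H →L[ℂ] H) :
    LinearMap.trace ℂ K (conjIsometry V X).toLinearMap = LinearMap.trace ℂ H X.toLinearMap := by
  rw [conjIsometry, trace_comp_comm_clm, comp_assoc, adjoint_comp_isometry, comp_id]

/-- Any operator factors isometrically through a Euclidean model of its range. -/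
theorem exists_isometry_range.{u} (T : H →L[ℂ] H) :
    ∃ (ι : Type u) (_ : Fintype ι) (J : EuclideanSpace ℂ ι →ₗᵢ[ℂ] H),
      J.toLinearMap.range = T.toLinearMap.range := by
  let b := (stdOrthonormalBasis ℂ T.toLinearMap.range).reindex Equiv.ulift.{u}.symm
  refine ⟨_, inferInstance,
    T.toLinearMap.range.subtypeₗᵢ.comp b.repr.symm.toLinearIsometry, ?_⟩
  ext x
  constructor
  · rintro ⟨y, rfl⟩
    exact (b.repr.symm y).2
  · intro hx
    exact ⟨b.repr ⟨x, hx⟩, by simp⟩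

theorem comp_adjoint_comp_of_range_eq {J : E →ₗᵢ[ℂ] H} {T : H →L[ℂ] H}
    (h : J.toLinearMap.range = T.toLinearMap.range) :
    (J.toContinuousLinearMap ∘L adjoint J.toContinuousLinearMap) ∘L T = T := by
  refine ContinuousLinearMap.ext fun x => ?_
  obtain ⟨y, hy⟩ : T x ∈ J.toLinearMap.range := h ▸ ⟨x, rfl⟩
  have hy' : J.toContinuousLinearMap y = T x := hy
  rw [comp_apply, ← hy', comp_apply, ← comp_apply (adjoint _), adjoint_comp_isometry, id_apply]

/-- If the projection onto the range of `V` fixes `Φ ⊗ σ` with `Φ` surjective, then `V` is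
onto `H' ⊗ range σ`, and hence can be inverted there. -/
theorem exists_isometry_inverse {G : Type*} [NormedAddCommGroup G] [InnerProductSpace ℂ G]
    (V : H →ₗᵢ[ℂ] H' ⊗[ℂ] K) {Φ : H' →L[ℂ] H'} (hΦ : FullRank Φ)
    {σ : K →L[ℂ] K} {J : G →ₗᵢ[ℂ] K} (hJ : J.toLinearMap.range = σ.toLinearMap.range)
    (h : (V.toContinuousLinearMap ∘L adjoint V.toContinuousLinearMap) ∘L mapL Φ σ = mapL Φ σ) :
    ∃ W : H' ⊗[ℂ] G →ₗᵢ[ℂ] H, V.comp W = mapIsometry LinearIsometry.id J := by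
  have hsurj : Φ.toLinearMap.range = ⊤ := Submodule.eq_top_of_finrank_eq hΦ
  let M := (mapIsometry (LinearIsometry.id : H' →ₗᵢ[ℂ] H') J)
  let W := adjoint V.toContinuousLinearMap ∘L M.toContinuousLinearMap
  have hVW : V.toContinuousLinearMap ∘L W = M.toContinuousLinearMap := by
    rw [← ContinuousLinearMap.coe_inj]
    refine TensorProduct.ext' fun a e => ?_
    obtain ⟨a', rfl⟩ : a ∈ Φ.toLinearMap.range := hsurj ▸ trivial
    obtain ⟨k, hk⟩ : J e ∈ σ.toLinearMap.range := hJ ▸ ⟨e, rfl⟩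
    have hM : M (Φ a' ⊗ₜ e) = mapL Φ σ (a' ⊗ₜ k) := by
      rw [mapL_tmul]
      exact congrArg (Φ a' ⊗ₜ ·) hk.symm
    have := congrArg (fun A => A (a' ⊗ₜ k)) h
    simp only [comp_apply] at this
    change V.toContinuousLinearMap (adjoint V.toContinuousLinearMap (M (Φ a' ⊗ₜ e))) =
      M (Φ a' ⊗ₜ e)
    rw [hM, this]
  have hVW' : ∀ x, V (W x) = M x := fun x => congrArg (fun A => A x) hVW
  refine ⟨⟨W.toLinearMap, fun x => ?_⟩, LinearIsometry.ext hVW'⟩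
  rw [← M.norm_map x, ← hVW', V.norm_map]
  rfl

theorem adjoint_one_sub_range_comp_self (V : H →ₗᵢ[ℂ] K) :
    adjoint (.id ℂ K - V.toContinuousLinearMap ∘L adjoint V.toContinuousLinearMap) ∘L
        (.id ℂ K - V.toContinuousLinearMap ∘L adjoint V.toContinuousLinearMap) =
      .id ℂ K - V.toContinuousLinearMap ∘L adjoint V.toContinuousLinearMap := by
  have h2 : (V.toContinuousLinearMap ∘L adjoint V.toContinuousLinearMap) ∘L
      (V.toContinuousLinearMap ∘L adjoint V.toContinuousLinearMap) =
      V.toContinuousLinearMap ∘L adjoint V.toContinuousLinearMap := by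
    rw [comp_assoc, ← comp_assoc (adjoint _), adjoint_comp_isometry, id_comp]
  rw [map_sub, adjoint_id, adjoint_comp, adjoint_adjoint, sub_comp, comp_sub, comp_sub, h2]
  simp

/-- A bipartite state lives on the tensor product of the supports of its marginals. -/
theorem exists_isDensity_conjIsometry {σ : H ⊗[ℂ] K →L[ℂ] H ⊗[ℂ] K} (hσ : IsDensity σ)
    {J : E →ₗᵢ[ℂ] H} (hJ : J.toLinearMap.range = (partialTraceRight σ).toLinearMap.range)
    {L : F →ₗᵢ[ℂ] K} (hL : L.toLinearMap.range = (partialTraceLeft σ).toLinearMap.range) :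
    ∃ τ : E ⊗[ℂ] F →L[ℂ] E ⊗[ℂ] F, IsDensity τ ∧ σ = conjIsometry (mapIsometry J L) τ := by
  set P := J.toContinuousLinearMap ∘L adjoint J.toContinuousLinearMap with hP
  set Q := L.toContinuousLinearMap ∘L adjoint L.toContinuousLinearMap with hQ
  have hPσ : mapL P (.id ℂ K) ∘L σ = σ := by
    have h0 : mapL (.id ℂ H - P) (.id ℂ K) ∘L σ = 0 := by
      apply comp_eq_zero_of_trace_eq_zero _ hσ.1
      · rw [← trace_partialTraceRight, partialTraceRight_mapL_comp, sub_comp,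
          comp_adjoint_comp_of_range_eq hJ, id_comp, sub_self]
        simp
      · rw [adjoint_mapL, ← mapL_comp,
          adjoint_one_sub_range_comp_self, adjoint_id, id_comp]
    have h1 : mapL (.id ℂ H - P) (.id ℂ K) + mapL P (.id ℂ K) = .id ℂ (H ⊗[ℂ] K) := by
      rw [← mapL_add_left]; simp
    calc mapL P (.id ℂ K) ∘L σ
        = (mapL (.id ℂ H - P) (.id ℂ K) + mapL P (.id ℂ K)) ∘L σ := by
          rw [add_comp, h0, zero_add]
      _ = σ := by rw [h1, id_comp]
  have hQσ : mapL (.id ℂ H) Q ∘L σ = σ := by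
    have h0 : mapL (.id ℂ H) (.id ℂ K - Q) ∘L σ = 0 := by
      apply comp_eq_zero_of_trace_eq_zero _ hσ.1
      · rw [← trace_partialTraceLeft, partialTraceLeft_mapL_comp, sub_comp,
          comp_adjoint_comp_of_range_eq hL, id_comp, sub_self]
        simp
      · rw [adjoint_mapL, ← mapL_comp,
          adjoint_one_sub_range_comp_self, adjoint_id, id_comp]
    have h1 : mapL (.id ℂ H) (.id ℂ K - Q) + mapL (.id ℂ H) Q = .id ℂ (H ⊗[ℂ] K) := by
      rw [← mapL_add_right]; simp
    calc mapL (.id ℂ H) Q ∘L σ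
        = (mapL (.id ℂ H) (.id ℂ K - Q) + mapL (.id ℂ H) Q) ∘L σ := by
          rw [add_comp, h0, zero_add]
      _ = σ := by rw [h1, id_comp]
  set G := (mapIsometry J L).toContinuousLinearMap with hG
  have hGG : G ∘L adjoint G = mapL P Q := by
    rw [hG, toContinuousLinearMap_mapIsometry, adjoint_mapL, ← mapL_comp]
  have hl : (G ∘L adjoint G) ∘L σ = σ := by
    have : mapL P Q = mapL P (.id ℂ K) ∘L mapL (.id ℂ H) Q := by
      rw [← mapL_comp, comp_id, id_comp]
    rw [hGG, this, comp_assoc, hQσ, hPσ]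
  have hr : σ ∘L (G ∘L adjoint G) = σ := by
    have := congrArg adjoint hl
    rwa [adjoint_comp, adjoint_comp, adjoint_adjoint, hσ.1.isSelfAdjoint.adjoint_eq] at this
  have heq : σ = conjIsometry (mapIsometry J L) (adjoint G ∘L σ ∘L G) := by
    rw [conjIsometry, ← hG]
    calc σ = (G ∘L adjoint G) ∘L σ ∘L (G ∘L adjoint G) := by rw [hr, hl]
      _ = _ := by simp only [comp_assoc]
  refine ⟨adjoint G ∘L σ ∘L G, ⟨hσ.1.adjoint_conj G, ?_⟩, heq⟩
  rw [← trace_conjIsometry (mapIsometry J L), ← heq, hσ.2]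

/-- The partial trace along an isometric embedding `W` of `K ⊗ E` into `H` extends to a quantum
channel on all of `L(H)`. -/
theorem exists_channel_of_isometry [Nontrivial K] (W : K ⊗[ℂ] E →ₗᵢ[ℂ] H) :
    ∃ Λ : (H →L[ℂ] H) →CP (K →L[ℂ] K), IsTracePreserving Λ.toLinearMap ∧
      ∀ X, Λ.toLinearMap (conjIsometry W X) = partialTraceRight X := by
  obtain ⟨u, hu⟩ := exists_norm_eq K zero_le_one
  let g := stdOrthonormalBasis ℂ E
  let e := stdOrthonormalBasis ℂ H
  set V := W.toContinuousLinearMap with hV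
  let Q : H →L[ℂ] H := .id ℂ H - V ∘L adjoint V
  have hVV : adjoint V ∘L V = .id ℂ _ := adjoint_comp_isometry W
  have hQV : Q ∘L V = 0 := by
    rw [sub_comp, comp_assoc, hVV, comp_id, id_comp, sub_self]
  have hQ : adjoint Q = Q := by
    simp only [Q, map_sub, adjoint_id, adjoint_comp, adjoint_adjoint]
  have hQQ : Q ∘L Q = Q := by
    conv_lhs => rhs; simp only [Q]
    rw [comp_sub, ← comp_assoc, hQV, zero_comp, sub_zero, comp_id]
  let M : (Fin (Module.finrank ℂ E)) ⊕ (Fin (Module.finrank ℂ H)) → H →L[ℂ] K :=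
    Sum.elim (fun m => adjoint (tmulRight K (g m)) ∘L adjoint V) (fun n => rankOne ℂ u (e n) ∘L Q)
  have hM : ∀ X, krausMap M X = partialTraceRight (adjoint V ∘L X ∘L V) +
      LinearMap.trace ℂ H (Q ∘L X ∘L Q).toLinearMap • rankOne ℂ u u := by
    intro X
    rw [krausMap_apply, Fintype.sum_sum_type, partialTraceRight_eq_sum g,
      LinearMap.trace_eq_sum_inner _ e, Finset.sum_smul]
    congr 1
    · refine Finset.sum_congr rfl fun m _ => ?_
      simp only [M, Sum.elim_inl, adjoint_comp, adjoint_adjoint, comp_assoc]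
    · refine Finset.sum_congr rfl fun n _ => ?_
      simp only [M, Sum.elim_inr, adjoint_comp, adjoint_rankOne, hQ]
      ext x
      simp [smul_smul, mul_comm]
  refine ⟨krausCP M, fun X => ?_, fun X => ?_⟩
  · change LinearMap.trace ℂ K (krausMap M X).toLinearMap = _
    have h1 : LinearMap.trace ℂ K (rankOne ℂ u u).toLinearMap = 1 := by
      rw [trace_rankOne, inner_self_eq_norm_sq_to_K, hu]; simp
    rw [hM, toLinearMap_add, map_add, trace_partialTraceRight, toLinearMap_smul, map_smul, h1,
      trace_comp_comm_clm, trace_comp_comm_clm Q, comp_assoc, comp_assoc, hQQ, smul_eq_mul,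
      mul_one, ← map_add,
      ← toLinearMap_add, ← comp_add]
    simp [Q]
  · change krausMap M _ = _
    rw [hM, conjIsometry, ← hV]
    have h1 : adjoint V ∘L (V ∘L X ∘L adjoint V) ∘L V = X := by
      rw [comp_assoc, comp_assoc, hVV, comp_id, ← comp_assoc, hVV, id_comp]
    have h2 : Q ∘L (V ∘L X ∘L adjoint V) ∘L Q = 0 := by
      rw [comp_assoc, ← comp_assoc, hQV, zero_comp]
    rw [h1, h2]
    simp

end Isometry

section Equivalence

variable {HA HB HA' HB' : Type*}
  [NormedAddCommGroup HA] [InnerProductSpace ℂ HA] [FiniteDimensional ℂ HA]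
  [NormedAddCommGroup HB] [InnerProductSpace ℂ HB] [FiniteDimensional ℂ HB]
  [NormedAddCommGroup HA'] [InnerProductSpace ℂ HA'] [FiniteDimensional ℂ HA']
  [NormedAddCommGroup HB'] [InnerProductSpace ℂ HB'] [FiniteDimensional ℂ HB']

set_option maxHeartbeats 4000000 in
theorem exists_local_isometries_of_channels.{u, v}
    {Φ : HA' ⊗[ℂ] HB' →L[ℂ] HA' ⊗[ℂ] HB'} (hΦ : IsDensity Φ) (hpure : Φ * Φ = Φ)
    {ρ : HA ⊗[ℂ] HB →L[ℂ] HA ⊗[ℂ] HB} (hρ : IsDensity ρ)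
    (ΛA : (HA →L[ℂ] HA) →CP (HA' →L[ℂ] HA')) (ΛB : (HB →L[ℂ] HB) →CP (HB' →L[ℂ] HB'))
    (hA : IsTracePreserving ΛA.toLinearMap) (hB : IsTracePreserving ΛB.toLinearMap)
    (h : channelTensor ΛA.toLinearMap ΛB.toLinearMap ρ = Φ) :
    ∃ (ι : Type u) (κ : Type v) (_ : Fintype ι) (_ : Fintype κ)
      (VA : HA →ₗᵢ[ℂ] HA' ⊗[ℂ] EuclideanSpace ℂ ι) (VB : HB →ₗᵢ[ℂ] HB' ⊗[ℂ] EuclideanSpace ℂ κ)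
      (σ : EuclideanSpace ℂ ι ⊗[ℂ] EuclideanSpace ℂ κ →L[ℂ]
        EuclideanSpace ℂ ι ⊗[ℂ] EuclideanSpace ℂ κ),
      IsDensity σ ∧ conjIsometry (mapIsometry VA VB) ρ = bipartiteTensor Φ σ := by
  obtain ⟨ι, _, VA, hVA⟩ := exists_stinespring ΛA hA
  obtain ⟨κ, _, VB, hVB⟩ := exists_stinespring ΛB hB
  have hY := isPositive_conjIsometry (mapIsometry VA VB) hρ.1
  have hptr := channelTensor_conjIsometry VA VB (fun X => (hVA X).symm) (fun X => (hVB X).symm) ρ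
  obtain ⟨σ, hσ, hR⟩ := exists_eq_mapL_of_partialTraceRight_pure hΦ hpure
    (isPositive_swapSymmL_conj hY)
    ((channelTensor_partialTraceRight _).symm.trans (hptr.trans h))
  exact ⟨ι, κ, _, _, VA, VB, σ, hσ, eq_bipartiteTensor_iff.mpr hR⟩

set_option maxHeartbeats 4000000 in
theorem exists_local_embeddings_of_isometries.{u, v} {KA KB : Type*}
    [NormedAddCommGroup KA] [InnerProductSpace ℂ KA] [FiniteDimensional ℂ KA]
    [NormedAddCommGroup KB] [InnerProductSpace ℂ KB] [FiniteDimensional ℂ KB]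
    {Φ : HA' ⊗[ℂ] HB' →L[ℂ] HA' ⊗[ℂ] HB'}
    (hΦA : FullRank (partialTraceRight Φ)) (hΦB : FullRank (partialTraceLeft Φ))
    {ρ : HA ⊗[ℂ] HB →L[ℂ] HA ⊗[ℂ] HB}
    (VA : HA →ₗᵢ[ℂ] HA' ⊗[ℂ] KA) (VB : HB →ₗᵢ[ℂ] HB' ⊗[ℂ] KB)
    {σ : KA ⊗[ℂ] KB →L[ℂ] KA ⊗[ℂ] KB} (hσ : IsDensity σ)
    (h : conjIsometry (mapIsometry VA VB) ρ = bipartiteTensor Φ σ) :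
    ∃ (ι : Type u) (κ : Type v) (_ : Fintype ι) (_ : Fintype κ)
      (WA : HA' ⊗[ℂ] EuclideanSpace ℂ ι →ₗᵢ[ℂ] HA) (WB : HB' ⊗[ℂ] EuclideanSpace ℂ κ →ₗᵢ[ℂ] HB)
      (τ : EuclideanSpace ℂ ι ⊗[ℂ] EuclideanSpace ℂ κ →L[ℂ]
        EuclideanSpace ℂ ι ⊗[ℂ] EuclideanSpace ℂ κ),
      IsDensity τ ∧ ρ = conjIsometry (mapIsometry WA WB) (bipartiteTensor Φ τ) := by
  obtain ⟨ι, _, J, hJ⟩ := exists_isometry_range.{_, u} (partialTraceRight σ)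
  obtain ⟨κ, _, L, hL⟩ := exists_isometry_range.{_, v} (partialTraceLeft σ)
  obtain ⟨τ, hτ, hστ⟩ := exists_isDensity_conjIsometry hσ hJ hL
  have hA : (VA.toContinuousLinearMap ∘L adjoint VA.toContinuousLinearMap) ∘L
      mapL (partialTraceRight Φ) (partialTraceRight σ) =
      mapL (partialTraceRight Φ) (partialTraceRight σ) := by
    have := range_comp_partialTraceRight VA VB ρ
    rwa [h, partialTraceRight_bipartiteTensor] at this
  have hB : (VB.toContinuousLinearMap ∘L adjoint VB.toContinuousLinearMap) ∘L
      mapL (partialTraceLeft Φ) (partialTraceLeft σ) =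
      mapL (partialTraceLeft Φ) (partialTraceLeft σ) := by
    have := range_comp_partialTraceLeft VA VB ρ
    rwa [h, partialTraceLeft_bipartiteTensor] at this
  obtain ⟨WA, hWA⟩ := exists_isometry_inverse VA hΦA hJ hA
  obtain ⟨WB, hWB⟩ := exists_isometry_inverse VB hΦB hL hB
  refine ⟨ι, κ, _, _, WA, WB, τ, hτ, conjIsometry_injective (mapIsometry VA VB) ?_⟩
  rw [h, hστ, bipartiteTensor_conjIsometry, ← hWA, ← hWB]
  exact conjIsometry_mapIsometry_comp VA VB WA WB _

set_option maxHeartbeats 4000000 in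
theorem exists_channels_of_embeddings {KA KB : Type*}
    [NormedAddCommGroup KA] [InnerProductSpace ℂ KA] [FiniteDimensional ℂ KA]
    [NormedAddCommGroup KB] [InnerProductSpace ℂ KB] [FiniteDimensional ℂ KB]
    {Φ : HA' ⊗[ℂ] HB' →L[ℂ] HA' ⊗[ℂ] HB'} (hΦ : IsDensity Φ)
    {ρ : HA ⊗[ℂ] HB →L[ℂ] HA ⊗[ℂ] HB}
    (WA : HA' ⊗[ℂ] KA →ₗᵢ[ℂ] HA) (WB : HB' ⊗[ℂ] KB →ₗᵢ[ℂ] HB)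
    {τ : KA ⊗[ℂ] KB →L[ℂ] KA ⊗[ℂ] KB} (hτ : IsDensity τ)
    (h : ρ = conjIsometry (mapIsometry WA WB) (bipartiteTensor Φ τ)) :
    ∃ (ΛA : (HA →L[ℂ] HA) →CP (HA' →L[ℂ] HA')) (ΛB : (HB →L[ℂ] HB) →CP (HB' →L[ℂ] HB')),
      IsTracePreserving ΛA.toLinearMap ∧ IsTracePreserving ΛB.toLinearMap ∧
      channelTensor ΛA.toLinearMap ΛB.toLinearMap ρ = Φ := by
  have hne : Nontrivial (HA' ⊗[ℂ] HB') := by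
    by_contra hc
    rw [not_nontrivial_iff_subsingleton] at hc
    have h0 : Φ = 0 := Subsingleton.elim _ _
    simpa [h0] using hΦ.2
  have hA : Nontrivial HA' := by
    by_contra hc
    rw [not_nontrivial_iff_subsingleton] at hc
    exact not_subsingleton (HA' ⊗[ℂ] HB') inferInstance
  have hB : Nontrivial HB' := by
    by_contra hc
    rw [not_nontrivial_iff_subsingleton] at hc
    exact not_subsingleton (HA' ⊗[ℂ] HB') inferInstance
  obtain ⟨ΛA, hΛA, hA⟩ := exists_channel_of_isometry WA
  obtain ⟨ΛB, hΛB, hB⟩ := exists_channel_of_isometry WB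
  refine ⟨ΛA, ΛB, hΛA, hΛB, ?_⟩
  rw [h, channelTensor_conjIsometry WA WB hA hB, channelTensor_partialTraceRight,
    eq_bipartiteTensor_iff.mp rfl, partialTraceRight_mapL, hτ.2, one_smul]

end Equivalence

end

end SelfTesting

theorem mainTheorem2
    {HA HB HA' HB' : Type*}
    [NormedAddCommGroup HA] [InnerProductSpace ℂ HA] [FiniteDimensional ℂ HA] [CompleteSpace HA]
    [NormedAddCommGroup HB] [InnerProductSpace ℂ HB] [FiniteDimensional ℂ HB] [CompleteSpace HB]
    [NormedAddCommGroup HA'] [InnerProductSpace ℂ HA'] [FiniteDimensional ℂ HA']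
    [CompleteSpace HA']
    [NormedAddCommGroup HB'] [InnerProductSpace ℂ HB'] [FiniteDimensional ℂ HB']
    [CompleteSpace HB']
    (Φ : HA' ⊗[ℂ] HB' →L[ℂ] HA' ⊗[ℂ] HB')
    (hΦ : SelfTesting.IsDensity Φ)
    (hΦ_pure : Φ * Φ = Φ)
    (hΦ_A : SelfTesting.FullRank (SelfTesting.partialTraceRight Φ))
    (hΦ_B : SelfTesting.FullRank (SelfTesting.partialTraceLeft Φ))
    (ρ : HA ⊗[ℂ] HB →L[ℂ] HA ⊗[ℂ] HB)
    (hρ : SelfTesting.IsDensity ρ) :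
    List.TFAE [
      ∃ (ΛA : (HA →L[ℂ] HA) →CP (HA' →L[ℂ] HA')) (ΛB : (HB →L[ℂ] HB) →CP (HB' →L[ℂ] HB')),
        SelfTesting.IsTracePreserving ΛA.toLinearMap ∧
        SelfTesting.IsTracePreserving ΛB.toLinearMap ∧
        SelfTesting.channelTensor ΛA.toLinearMap ΛB.toLinearMap ρ = Φ,
      ∃ (KA KB : Type*)
        (_ : NormedAddCommGroup KA) (_ : InnerProductSpace ℂ KA) (_ : FiniteDimensional ℂ KA)
        (_ : NormedAddCommGroup KB) (_ : InnerProductSpace ℂ KB) (_ : FiniteDimensional ℂ KB)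
        (VA : HA →ₗᵢ[ℂ] HA' ⊗[ℂ] KA) (VB : HB →ₗᵢ[ℂ] HB' ⊗[ℂ] KB)
        (σ : KA ⊗[ℂ] KB →L[ℂ] KA ⊗[ℂ] KB),
        SelfTesting.IsDensity σ ∧
        SelfTesting.conjIsometry (TensorProduct.mapIsometry VA VB) ρ =
          SelfTesting.bipartiteTensor Φ σ,
      ∃ (KA KB : Type*)
        (_ : NormedAddCommGroup KA) (_ : InnerProductSpace ℂ KA) (_ : FiniteDimensional ℂ KA)
        (_ : NormedAddCommGroup KB) (_ : InnerProductSpace ℂ KB) (_ : FiniteDimensional ℂ KB)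
        (WA : HA' ⊗[ℂ] KA →ₗᵢ[ℂ] HA) (WB : HB' ⊗[ℂ] KB →ₗᵢ[ℂ] HB)
        (τ : KA ⊗[ℂ] KB →L[ℂ] KA ⊗[ℂ] KB),
        SelfTesting.IsDensity τ ∧
        ρ = SelfTesting.conjIsometry (TensorProduct.mapIsometry WA WB)
          (SelfTesting.bipartiteTensor Φ τ)] := by

  tfae_have 1 → 2 := by
    rintro ⟨ΛA, ΛB, hA, hB, h⟩
    obtain ⟨ι, κ, _, _, VA, VB, σ, hσ, hV⟩ :=
      SelfTesting.exists_local_isometries_of_channels hΦ hΦ_pure hρ ΛA ΛB hA hB h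
    exact ⟨EuclideanSpace ℂ ι, EuclideanSpace ℂ κ, inferInstance, inferInstance, inferInstance,
      inferInstance, inferInstance, inferInstance, VA, VB, σ, hσ, hV⟩
  tfae_have 2 → 3 := by
    rintro ⟨KA, KB, _, _, _, _, _, _, VA, VB, σ, hσ, hV⟩
    obtain ⟨ι, κ, _, _, WA, WB, τ, hτ, hW⟩ :=
      SelfTesting.exists_local_embeddings_of_isometries hΦ_A hΦ_B VA VB hσ hV
    exact ⟨EuclideanSpace ℂ ι, EuclideanSpace ℂ κ, inferInstance, inferInstance, inferInstance,
      inferInstance, inferInstance, inferInstance, WA, WB, τ, hτ, hW⟩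
  tfae_have 3 → 1 := by
    rintro ⟨KA, KB, _, _, _, _, _, _, WA, WB, τ, hτ, hW⟩
    exact SelfTesting.exists_channels_of_embeddings hΦ WA WB hτ hW
  tfae_finish
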